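/- \textbf{Setting.} Let $\mathcal U,\mathcal B,\mathcal L,\mathcal V$ be pairwise disjoint, countably infinite sets of URIs, blank nodes, literals and variables, each indexed by $\mathbb N$. An RDF triple is an element of $\mathcal T=(\mathcal U\cup\mathcal B)\times\mathcal U\times(\mathcal U\cup\mathcal B\cup\mathcal L)$. A \emph{Web of Linked Data} is a tuple $W=(D,\mathrm{data},\mathrm{adoc})$ with $D$ a countable set of documents, $\mathrm{data}$ assigning to each $d\in D$ a finite set of triples such that distinct documents share no blank nodes, and $\mathrm{adoc}:\mathcal U\rightharpoonup D$ a partial surjective map. SPARQL expressions are built from triple patterns by AND, UNION, OPT and FILTER, and $[\![P]\!]_G$ denotes the usual set of solutions (partial maps $\mathcal V\rightharpoonup\mathcal U\cup\mathcal B\cup\mathcal L$) of $P$ over a possibly infinite set $G$ of triples. A \emph{reachability criterion} is a Turing computable function $c$ that maps each (triple, URI, SPARQL expression) to true or false. A document $d$ of $W$ is $(c,P)$-reachable from a finite set $S\subset\mathcal U$ if $d=\mathrm{adoc}(u)$ for some $u\in S$, or if $d=\mathrm{adoc}(u)$ for some URI $u$ occurring in a triple $t\in\mathrm{data}(d')$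 with $d'$ a $(c,P)$-reachable document and $c(t,u,P)$ true. The $(S,c,P)$-reachable part of $W$ is the subweb induced by these documents; $c$ \emph{ensures finiteness} if this part is finite for all $W$, all finite $S$ and all $P$. The SPARQL$_{\mathrm{LD(R)}}$ query $Q_c^{P,S}$ maps $W$ to $[\![P]\!]_G$, where $G$ is the set of all triples in the documents of the $(S,c,P)$-reachable part of $W$. Encodings: URIs etc. are encoded in binary (with a marker for the kind), finite sets of triples as lists in a fixed order, $\mathrm{enc}(d)=\mathrm{enc}(\mathrm{data}(d))$, $\mathrm{enc}(W)=\sharp\,\mathrm{enc}(u_1)\,\mathrm{enc}(\mathrm{adoc}(u_1))\,\sharp\,\mathrm{enc}(u_2)\,\mathrm{enc}(\mathrm{adoc}(u_2))\,\sharp\cdots$ (possibly infinite), where $u_1,u_2,\dots$ lists $\mathrm{dom}(\mathrm{adoc})$ in order, and a set of solutions is encoded by concatenating the encodings of its elements in any order. An \emph{LD machine} is a Turing machine with finitely many states, a read-only input tape, a read-only Web tape, a work tape, a link traversal tape and an append-only output tape. The Web tape holds $\mathrm{enc}(W)$ and is accessed only in a special \emph{expand} state: if the word on the link traversal tape ends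 in $\mathrm{enc}(u)$ for a URI $u$ and $\sharp\,\mathrm{enc}(u)\,\mathrm{enc}(\mathrm{adoc}(u))\,\sharp$ occurs on the Web tape, then $\mathrm{enc}(\mathrm{adoc}(u))\,\sharp$ is appended to the link traversal tape, otherwise $\sharp$ is appended. A decision problem whose input is a Web $W$ and a finite structure $X$ is \emph{LD machine decidable} if some LD machine, for every $W$ on its Web tape and every encoded $X$ on its input tape, halts in an accepting state if the answer is yes and in a rejecting state if the answer is no. \textbf{Theorem.} Consider the problem Termination(SPARQL$_{\mathrm{LD(R)}}$). Its Web input is a (possibly infinite) Web of Linked Data $W$; its ordinary input consists of a finite nonempty set $S\subset\mathcal U$, a reachability criterion $c$ that does not ensure finiteness, and a SPARQL expression $P$. The question is: does an LD machine exist that computes $Q_c^{P,S}(W)$ and halts? For every encoding of the ordinary inputs $(S,c,P)$ by words, this problem is not LD machine decidable, under each of the following two readings of the question. (a) There is an LD machine (with empty ordinary input) that halts on $W$ and that, on every Web $W'$ on which it halts, has produced an encoding of $Q_c^{P,S}(W')$ on its output tape. (b) There is an LD machine (with empty ordinary input) that halts on $W$ with an encoding of $Q_c^{P,S}(W)$ on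 its output tape. -/

import Mathlib

namespace LinkedData

/-! Pairwise disjoint, countably infinite sets of URIs, blank nodes, literals and variables.
The total order on each of them is the order of the index. -/

/-- URIs. -/
structure URI where
  idx : ℕ
  deriving DecidableEq

/-- Blank nodes. -/
structure BNode where
  idx : ℕ
  deriving DecidableEq

/-- Literals. -/
structure Lit where
  idx : ℕ
  deriving DecidableEq

/-- Query variables. -/
structure Var where
  idx : ℕ
  deriving DecidableEq

/-- RDF terms: URIs, blank nodes and literals. -/
inductive Term where
  | uri (u : URI)
  | bnode (b : BNode)
  | lit (l : Lit)
  deriving DecidableEq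

/-- An RDF triple: the subject is a URI or a blank node, the predicate is a URI, the object is any
RDF term. -/
@[ext]
structure Triple where
  s : Term
  p : URI
  o : Term
  s_not_lit : ∀ l : Lit, s ≠ Term.lit l

namespace Triple

/-- `terms(t)`. -/
def terms (t : Triple) : Set Term := {t.s, Term.uri t.p, t.o}

/-- `uris(t) = terms(t) ∩ URIs`. -/
def uris (t : Triple) : Set URI := {u | Term.uri u ∈ t.terms}

end Triple

/-! ### A total order on triples -/

/-- Position of a term in a total order of all terms that restricts to the given orders of the URIs,
the blank nodes and the literals. -/
def Term.rank : Term → ℕ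
  | .uri u => 3 * u.idx
  | .bnode b => 3 * b.idx + 1
  | .lit l => 3 * l.idx + 2

theorem Term.rank_injective : Function.Injective Term.rank := by
  rintro (⟨⟨a⟩⟩ | ⟨⟨a⟩⟩ | ⟨⟨a⟩⟩) (⟨⟨b⟩⟩ | ⟨⟨b⟩⟩ | ⟨⟨b⟩⟩) h <;> simp only [Term.rank] at h
  all_goals first
    | omega
    | (obtain rfl : a = b := by omega
       rfl)

/-- Triples are compared lexicographically. -/
def Triple.rank (t : Triple) : ℕ ×ₗ ℕ ×ₗ ℕ :=
  toLex (t.s.rank, toLex (t.p.idx, t.o.rank))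

theorem Triple.rank_injective : Function.Injective Triple.rank := by
  rintro ⟨s, ⟨p⟩, o, hs⟩ ⟨s', ⟨p'⟩, o', hs'⟩ h
  have h1 := congrArg ofLex h
  simp only [Triple.rank, ofLex_toLex, Prod.mk.injEq, EmbeddingLike.apply_eq_iff_eq] at h1
  obtain ⟨h1, h2, h3⟩ := h1
  obtain rfl := Term.rank_injective h1
  obtain rfl := Term.rank_injective h3
  subst h2
  rfl

noncomputable instance : LinearOrder Triple :=
  LinearOrder.lift' Triple.rank Triple.rank_injective

/-! ### Webs of Linked Data -/

/-- A Web of Linked Data `(D, data, adoc)`: a countable set `D` of documents, a finite set of triples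
for each document such that distinct documents share no blank nodes, and a partial surjective
mapping `adoc` from URIs to documents. -/
structure Web where
  Doc : Type
  countable_doc : Countable Doc
  data : Doc → Finset Triple
  bnodes_disjoint : ∀ d₁ d₂ : Doc, d₁ ≠ d₂ → ∀ t₁ ∈ data d₁, ∀ t₂ ∈ data d₂, ∀ b : BNode,
    ¬ (Term.bnode b ∈ t₁.terms ∧ Term.bnode b ∈ t₂.terms)
  adoc : URI → Option Doc
  adoc_surjective : ∀ d : Doc, ∃ u : URI, adoc u = some d

namespace Web

/-- The set of all triples in the documents of a Web. -/
def allData (W : Web) : Set Triple := {t | ∃ d : W.Doc, t ∈ W.data d}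

open Classical in
/-- The induced subweb with a given set `D'` of documents. -/
noncomputable def inducedSubweb (W : Web) (D' : Set W.Doc) : Web where
  Doc := {d : W.Doc // d ∈ D'}
  countable_doc := by
    have := W.countable_doc
    infer_instance
  data := fun d => W.data d.1
  bnodes_disjoint := fun d₁ d₂ h => W.bnodes_disjoint d₁.1 d₂.1 (fun h' => h (Subtype.ext h'))
  adoc := fun u => (W.adoc u).bind fun d => if h : d ∈ D' then some ⟨d, h⟩ else none
  adoc_surjective := by
    rintro ⟨d, hd⟩
    obtain ⟨u, hu⟩ := W.adoc_surjective d
    exact ⟨u, by simp [hu, hd]⟩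

end Web

/-! ### SPARQL expressions and their evaluation -/

/-- A triple pattern in `(V ∪ U) × (V ∪ U) × (V ∪ U ∪ L)`. -/
structure TriplePattern where
  s : Var ⊕ URI
  p : Var ⊕ URI
  o : Var ⊕ (URI ⊕ Lit)

/-- SPARQL filter conditions. -/
inductive Filter where
  | eqConst (x : Var) (c : URI ⊕ Lit)
  | eqVar (x y : Var)
  | bound (x : Var)
  | not (R : Filter)
  | and (R₁ R₂ : Filter)
  | or (R₁ R₂ : Filter)

/-- SPARQL expressions. -/
inductive Expr where
  | tp (t : TriplePattern)
  | and (P₁ P₂ : Expr)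
  | union (P₁ P₂ : Expr)
  | opt (P₁ P₂ : Expr)
  | filter (P : Expr) (R : Filter)

/-- Valuations: partial mappings from variables to RDF terms. -/
abbrev Valuation := Var → Option Term

namespace Valuation

/-- The domain of a valuation. -/
def dom (μ : Valuation) : Set Var := {v | (μ v).isSome}

/-- Two valuations are compatible if they agree where both are defined. -/
def Compatible (μ ν : Valuation) : Prop :=
  ∀ v a b, μ v = some a → ν v = some b → a = b

/-- The union of two (compatible) valuations. -/
def union (μ ν : Valuation) : Valuation := fun v => (μ v).orElse fun _ => ν v

end Valuation

/-- A URI or a literal as an RDF term. -/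
def constTerm : URI ⊕ Lit → Term
  | .inl u => .uri u
  | .inr l => .lit l

/-- `μ` satisfies the filter condition. -/
def Filter.Sat (μ : Valuation) : Filter → Prop
  | .eqConst x c => μ x = some (constTerm c)
  | .eqVar x y => ∃ a, μ x = some a ∧ μ y = some a
  | .bound x => x ∈ μ.dom
  | .not R => ¬ R.Sat μ
  | .and R₁ R₂ => R₁.Sat μ ∧ R₂.Sat μ
  | .or R₁ R₂ => R₁.Sat μ ∨ R₂.Sat μ

namespace TriplePattern

/-- The variables of a triple pattern. -/
def vars (tp : TriplePattern) : Set Var :=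
  {v | tp.s = .inl v ∨ tp.p = .inl v ∨ tp.o = .inl v}

/-- The application `μ[tp]` of a valuation to a triple pattern is the triple `t`. -/
def Instantiates (μ : Valuation) (tp : TriplePattern) (t : Triple) : Prop :=
  tp.s.elim μ (fun u => some (.uri u)) = some t.s ∧
  tp.p.elim μ (fun u => some (.uri u)) = some (.uri t.p) ∧
  tp.o.elim μ (fun c => some (constTerm c)) = some t.o

end TriplePattern

/-- `Ω₁ ⋈ Ω₂`. -/
def joinSets (Ω₁ Ω₂ : Set Valuation) : Set Valuation :=
  {μ | ∃ μ₁ ∈ Ω₁, ∃ μ₂ ∈ Ω₂, μ₁.Compatible μ₂ ∧ μ = μ₁.union μ₂}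

/-- `Ω₁ \ Ω₂` in the sense of the SPARQL algebra. -/
def minusSets (Ω₁ Ω₂ : Set Valuation) : Set Valuation :=
  {μ | μ ∈ Ω₁ ∧ ∀ ν ∈ Ω₂, ¬ μ.Compatible ν}

/-- The evaluation of a SPARQL expression over a (potentially infinite) set of triples. -/
def Expr.eval (G : Set Triple) : Expr → Set Valuation
  | .tp t => {μ | μ.dom = t.vars ∧ ∃ a ∈ G, t.Instantiates μ a}
  | .and P₁ P₂ => joinSets (P₁.eval G) (P₂.eval G)
  | .union P₁ P₂ => P₁.eval G ∪ P₂.eval G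
  | .opt P₁ P₂ => joinSets (P₁.eval G) (P₂.eval G) ∪ minusSets (P₁.eval G) (P₂.eval G)
  | .filter P R => {μ | μ ∈ P.eval G ∧ R.Sat μ}

/-! ### Serialization, used to say that a reachability criterion is Turing computable -/

/-- A term as a list of numbers. -/
def Term.code : Term → List ℕ
  | .uri u => [0, u.idx]
  | .bnode b => [1, b.idx]
  | .lit l => [2, l.idx]

/-- A triple as a list of numbers. -/
def Triple.code (t : Triple) : List ℕ := t.s.code ++ [t.p.idx] ++ t.o.code

/-- A variable or URI as a list of numbers. -/
def codeVarURI : Var ⊕ URI → List ℕ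
  | .inl v => [0, v.idx]
  | .inr u => [1, u.idx]

/-- A URI or literal as a list of numbers. -/
def codeConst : URI ⊕ Lit → List ℕ
  | .inl u => [1, u.idx]
  | .inr l => [2, l.idx]

/-- A variable, URI or literal as a list of numbers. -/
def codeObj : Var ⊕ (URI ⊕ Lit) → List ℕ
  | .inl v => [0, v.idx]
  | .inr c => codeConst c

/-- A filter condition in prefix form. -/
def Filter.code : Filter → List ℕ
  | .eqConst x c => 0 :: x.idx :: codeConst c
  | .eqVar x y => [1, x.idx, y.idx]
  | .bound x => [2, x.idx]
  | .not R => 3 :: R.code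
  | .and R₁ R₂ => 4 :: (R₁.code ++ R₂.code)
  | .or R₁ R₂ => 5 :: (R₁.code ++ R₂.code)

/-- A SPARQL expression in prefix form. -/
def Expr.code : Expr → List ℕ
  | .tp t => 0 :: (codeVarURI t.s ++ codeVarURI t.p ++ codeObj t.o)
  | .and P₁ P₂ => 1 :: (P₁.code ++ P₂.code)
  | .union P₁ P₂ => 2 :: (P₁.code ++ P₂.code)
  | .opt P₁ P₂ => 3 :: (P₁.code ++ P₂.code)
  | .filter P R => 4 :: (P.code ++ R.code)

/-- The argument `(t, u, P)` of a reachability criterion as a list of numbers. -/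
def codeArg (t : Triple) (u : URI) (P : Expr) : List ℕ := t.code ++ [u.idx] ++ P.code

/-! ### Reachability-based semantics -/

/-- A reachability criterion: a Turing computable function from triples, URIs and SPARQL expressions
to truth values. -/
structure Criterion where
  toFun : Triple → URI → Expr → Bool
  computable : ∃ f : List ℕ → Bool, Computable f ∧ ∀ t u P, f (codeArg t u P) = toFun t u P

/-- A document is `(c, P)`-reachable from `S` in `W`. -/
inductive Reachable (W : Web) (S : Finset URI) (c : Criterion) (P : Expr) : W.Doc → Prop where
  | seed (u : URI) (d : W.Doc) : u ∈ S → W.adoc u = some d → Reachable W S c P d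
  | link (d' d : W.Doc) (t : Triple) (u : URI) : Reachable W S c P d' → t ∈ W.data d' →
      u ∈ t.uris → c.toFun t u P = true → W.adoc u = some d → Reachable W S c P d

/-- The `(S, c, P)`-reachable part of `W`. -/
noncomputable def reachablePart (W : Web) (S : Finset URI) (c : Criterion) (P : Expr) : Web :=
  W.inducedSubweb {d | Reachable W S c P d}

/-- A criterion ensures finiteness if all reachable parts that it defines are finite. -/
def Criterion.EnsuresFiniteness (c : Criterion) : Prop :=
  ∀ (W : Web) (S : Finset URI) (P : Expr), Finite (reachablePart W S c P).Doc

/-- A Linked Data query. -/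
abbrev Query := Web → Set Valuation

/-- The SPARQL query that uses `P`, `S` and `c` under reachability-based semantics. -/
noncomputable def reachQuery (P : Expr) (S : Finset URI) (c : Criterion) : Query :=
  fun W => P.eval (reachablePart W S c P).allData

/-! ### Encodings -/

/-- The symbols used by the encodings. `kindU`, `kindB`, `kindL`, `kindV` open the representation of a
URI, blank node, literal, variable. -/
inductive Sym where
  | zero | one
  | kindU | kindB | kindL | kindV
  | lang | rang
  | llang | rrang
  | comma | arrow | sharp
  deriving DecidableEq

/-- Binary representation of a number. -/
def encNat (n : ℕ) : List Sym := n.bits.map fun b => if b then Sym.one else Sym.zero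

/-- Encoding of a URI. -/
def encURI (u : URI) : List Sym := Sym.kindU :: encNat u.idx

/-- Encoding of a variable. -/
def encVar (v : Var) : List Sym := Sym.kindV :: encNat v.idx

/-- Encoding of a term. -/
def encTerm : Term → List Sym
  | .uri u => encURI u
  | .bnode b => Sym.kindB :: encNat b.idx
  | .lit l => Sym.kindL :: encNat l.idx

/-- Encoding of a triple. -/
def encTriple (t : Triple) : List Sym :=
  [Sym.lang] ++ encTerm t.s ++ [Sym.comma] ++ encURI t.p ++ [Sym.comma] ++ encTerm t.o ++ [Sym.rang]

/-- Encoding of a finite set of triples, listed in increasing order. -/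
noncomputable def encTriples (T : Finset Triple) : List Sym :=
  [Sym.llang] ++ List.intercalate [Sym.comma] ((T.sort (· ≤ ·)).map encTriple) ++ [Sym.rrang]

/-- Encoding of a document. -/
noncomputable def Web.encDoc (W : Web) (d : W.Doc) : List Sym := encTriples (W.data d)

/-- The part of the (potentially infinite) word `enc(W)` that describes the URIs with index below
`n`. The word `enc(W)` is the limit of these prefixes. -/
noncomputable def Web.encPrefix (W : Web) (n : ℕ) : List Sym :=
  Sym.sharp :: (List.range n).flatMap fun i =>
    match W.adoc ⟨i⟩ with
    | some d => encURI ⟨i⟩ ++ W.encDoc d ++ [Sym.sharp]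
    | none => []

/-- The word `enc(W)` on the Web tape contains the finite word `x`. -/
def Web.EncContains (W : Web) (x : List Sym) : Prop := ∃ n, x <:+: W.encPrefix n

/-- `w` encodes the valuation `μ`, with its variables listed in increasing order. -/
def EncodesValuation (μ : Valuation) (w : List Sym) : Prop :=
  ∃ l : List (Var × Term), (l.map fun p => p.1.idx).Pairwise (· < ·) ∧
    (∀ v a, (v, a) ∈ l ↔ μ v = some a) ∧
    w = [Sym.llang] ++ List.intercalate [Sym.comma]
      (l.map fun p => encVar p.1 ++ [Sym.arrow] ++ encTerm p.2) ++ [Sym.rrang]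

/-- The finite word `w` is a possible encoding of the set `Ω` of valuations: the concatenation of the
encodings of its elements in some order. -/
def EncodesSet (Ω : Set Valuation) (w : List Sym) : Prop :=
  ∃ l : List Valuation, l.Nodup ∧ (∀ μ, μ ∈ l ↔ μ ∈ Ω) ∧
    ∃ ws : List (List Sym), List.Forall₂ EncodesValuation l ws ∧ w = ws.flatten

/-! ### LD machines -/

/-- What a machine does in one step: next state, move of the head on the ordinary input tape, symbols
written on and moves of the heads on the work tape and the link traversal tape (`none` is the blank
symbol, respectively no move), and possibly a symbol appended to the output tape. -/
structure Action (State A : Type) where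
  next : State
  inputMove : Option Turing.Dir
  workWrite : Option A
  workMove : Option Turing.Dir
  linkWrite : Option A
  linkMove : Option Turing.Dir
  output : Option Sym

/-- An LD machine: finitely many states, among them the expand state, and a finite work alphabet
that consists of the encoding symbols and finitely many additional symbols. The transition function
gets the symbols under the heads of the ordinary input tape, the work tape and the link traversal
tape; the machine halts where it is undefined. -/
structure LDMachine where
  State : Type
  finite_state : Finite State
  Extra : Type
  finite_extra : Finite Extra
  start : State
  expand : State
  accepting : Set State
  rejecting : Set State
  disjoint : Disjoint accepting rejecting
  trans : State → Option Sym → Option (Sym ⊕ Extra) → Option (Sym ⊕ Extra) →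
    Option (Action State (Sym ⊕ Extra))

/-- A right-infinite tape with its head. Cells beyond the list are blank. -/
structure RightTape (A : Type) where
  cells : List (Option A)
  pos : ℕ

namespace RightTape

variable {A : Type}

/-- The symbol under the head. -/
def read (T : RightTape A) : Option A := T.cells.getD T.pos none

/-- Write under the head. -/
def write (T : RightTape A) (a : Option A) : RightTape A where
  cells := (T.cells ++ List.replicate (T.pos + 1 - T.cells.length) none).set T.pos a
  pos := T.pos

/-- Move the head; at the left end of the tape a move to the left has no effect. -/
def move (T : RightTape A) : Option Turing.Dir → RightTape A
  | none => T
  | some .left => { T with pos := T.pos - 1 }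
  | some .right => { T with pos := T.pos + 1 }

open Classical in
/-- The word on the tape: the cells up to the last one that is not blank. -/
noncomputable def word (T : RightTape A) : List (Option A) := T.cells.rdropWhile fun a => a = none

/-- Append symbols at the right end of the word on the tape. -/
noncomputable def append (T : RightTape A) (x : List A) : RightTape A where
  cells := T.word ++ x.map some
  pos := T.pos

end RightTape

/-- Move the head of a two-way infinite tape. -/
def moveTape {A : Type} (T : Turing.Tape (Option A)) : Option Turing.Dir → Turing.Tape (Option A)
  | none => T
  | some D => T.move D

namespace LDMachine

/-- Symbols of the work alphabet. -/
abbrev Alphabet (M : LDMachine) : Type := Sym ⊕ M.Extra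

/-- Configurations of a machine, apart from the Web tape, which never changes. -/
structure Config (M : LDMachine) where
  state : M.State
  input : Turing.Tape (Option Sym)
  work : Turing.Tape (Option M.Alphabet)
  link : RightTape M.Alphabet
  output : List Sym

/-- `w`, the word on the link traversal tape, ends in `enc(u)` for some URI `u`, the Web tape contains
`# enc(u) enc(adoc(u)) #`, and `x` is `enc(adoc(u)) #`. -/
def LookupSucceeds {E : Type} (W : Web) (w : List (Option (Sym ⊕ E))) (x : List Sym) : Prop :=
  ∃ (u : URI) (d : W.Doc), (encURI u).map (fun a => some (Sum.inl a)) <:+ w ∧ W.adoc u = some d ∧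
    W.EncContains ([Sym.sharp] ++ encURI u ++ W.encDoc d ++ [Sym.sharp]) ∧
    x = W.encDoc d ++ [Sym.sharp]

/-- The word to be copied from the Web tape is unique. -/
theorem LookupSucceeds.unique {E : Type} {W : Web} {w : List (Option (Sym ⊕ E))} {x y : List Sym}
    (hx : LookupSucceeds W w x) (hy : LookupSucceeds W w y) : x = y := by
  have key : ∀ u v : URI,
      (encURI u).map (fun a => some (Sum.inl a : Sym ⊕ E)) <:+
        (encURI v).map (fun a => some (Sum.inl a : Sym ⊕ E)) → u = v := by
    intro u v h
    have hnot : ∀ n : ℕ, some (Sum.inl Sym.kindU : Sym ⊕ E) ∉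
        (encNat n).map (fun a => some (Sum.inl a : Sym ⊕ E)) := by
      intro n hn
      simp only [encNat, List.map_map, List.mem_map, Function.comp] at hn
      obtain ⟨b, _, hb⟩ := hn
      cases b <;> simp at hb
    simp only [encURI, List.map_cons] at h
    rcases List.suffix_cons_iff.1 h with h | h
    · have h1 := (List.cons.inj h).2
      have h2 : encNat u.idx = encNat v.idx :=
        List.map_injective_iff.2 (fun a b hab => by simpa using hab) h1
      have h3 : u.idx.bits = v.idx.bits :=
        List.map_injective_iff.2 (fun a b hab => by cases a <;> cases b <;> simp_all) h2
      have h4 : u.idx = v.idx := by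
        apply Nat.eq_of_testBit_eq
        intro i
        rw [Nat.testBit_eq_inth, Nat.testBit_eq_inth, h3]
      cases u; cases v; simp_all
    · exact absurd (h.subset List.mem_cons_self) (hnot _)
  obtain ⟨u, d, hu, hd, -, rfl⟩ := hx
  obtain ⟨v, e, hv, he, -, rfl⟩ := hy
  have huv : u = v := by
    rcases List.suffix_or_suffix_of_suffix hu hv with h | h
    · exact key u v h
    · exact (key v u h).symm
  subst huv
  rw [hd] at he
  cases he
  rfl

open Classical in
/-- The word that the expand procedure appends. -/
noncomputable def lookup {E : Type} (W : Web) (w : List (Option (Sym ⊕ E))) : List Sym :=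
  if h : ∃ x, LookupSucceeds W w x then h.choose else [Sym.sharp]

/-- The expand procedure on the link traversal tape. -/
noncomputable def expandTape (M : LDMachine) (W : Web) (T : RightTape M.Alphabet) :
    RightTape M.Alphabet :=
  T.append ((lookup W T.word).map Sum.inl)

/-- One ordinary step; `none` if the machine halts. -/
def ordinaryStep (M : LDMachine) (C : M.Config) : Option M.Config :=
  (M.trans C.state C.input.head C.work.head C.link.read).map fun a =>
    { state := a.next
      input := moveTape C.input a.inputMove
      work := moveTape (C.work.write a.workWrite) a.workMove
      link := (C.link.write a.linkWrite).move a.linkMove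
      output := C.output ++ a.output.toList }

open Classical in
/-- One step with `enc(W)` on the Web tape: in the expand state the expand procedure is performed
before the transition out of that state. -/
noncomputable def step (M : LDMachine) (W : Web) (C : M.Config) : Option M.Config :=
  if C.state = M.expand then M.ordinaryStep { C with link := M.expandTape W C.link }
  else M.ordinaryStep C

/-- The initial configuration with the word `x` on the ordinary input tape. -/
def init (M : LDMachine) (x : List Sym) : M.Config where
  state := M.start
  input := Turing.Tape.mk₁ (x.map some)
  work := Turing.Tape.mk₁ []
  link := ⟨[], 0⟩
  output := []

/-- The computation of `M` with `enc(W)` on the Web tape and `x` on the ordinary input tape halts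
after finitely many steps, in the configuration `C`. -/
def HaltsIn (M : LDMachine) (W : Web) (x : List Sym) (C : M.Config) : Prop :=
  Relation.ReflTransGen (fun C₁ C₂ => M.step W C₁ = some C₂) (M.init x) C ∧ M.step W C = none

/-- `M` computes `q(W)` and halts: on `W` it halts with a possible encoding of `q(W)` on its output
tape. -/
def ComputesAndHalts (M : LDMachine) (q : Query) (W : Web) : Prop :=
  ∃ C : M.Config, M.HaltsIn W [] C ∧ EncodesSet (q W) C.output

/-- `M` is a machine for the query `q`: on every Web on which it halts, the output is a possible
encoding of the query result. -/
def IsMachineFor (M : LDMachine) (q : Query) : Prop :=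
  ∀ (W : Web) (C : M.Config), M.HaltsIn W [] C → EncodesSet (q W) C.output

end LDMachine

/-- LD machine decidability of the decision problem `DP` whose input consists of a Web and of an
element of `X`, which is encoded on the ordinary input tape by `enc`. -/
def LDMachineDecidable {X : Type} (enc : X → List Sym) (DP : Set (Web × X)) : Prop :=
  ∃ M : LDMachine, ∀ (W : Web) (x : X), ∃ C : M.Config, M.HaltsIn W (enc x) C ∧
    ((W, x) ∈ DP → C.state ∈ M.accepting) ∧ ((W, x) ∉ DP → C.state ∈ M.rejecting)

/-! ### The termination problem -/

/-- Ordinary input of the termination problem: a finite nonempty set of seed URIs, a reachability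
criterion that does not ensure finiteness and a SPARQL expression. -/
structure TerminationInput where
  S : Finset URI
  S_nonempty : S.Nonempty
  c : Criterion
  c_not_finite : ¬ c.EnsuresFiniteness
  P : Expr

/-- The query given by an input. -/
noncomputable def TerminationInput.query (X : TerminationInput) : Query := reachQuery X.P X.S X.c

/-- Does an LD machine for the query exist that computes the query result over `W` and halts? -/
def termination : Set (Web × TerminationInput) :=
  {i | ∃ M : LDMachine, M.IsMachineFor i.2.query ∧ M.ComputesAndHalts i.2.query i.1}

/-- The same question, with a machine that only has to be correct over the given Web. -/
def terminationNonuniform : Set (Web × TerminationInput) :=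
  {i | ∃ M : LDMachine, M.ComputesAndHalts i.2.query i.1}

end LinkedData

/-! One ordinary input suffices: seed URI 0, follow every link, ask for `(?x, ?x, ?x)`. On the chain
`linkWeb Nat.succ`, where document `i` holds only a link to `i + 1`, everything is reachable and the
result is infinite. No finite output encodes it, so the answer is no even in the weaker reading (b).

A decider rejects the chain after finitely many steps. Each step consults the Web through at most
one lookup, of one URI, so beyond some bound no document has been seen. Redirect the link of
document `N`, for `N` beyond that bound, back to 0: on `linkWeb (cycle N)` the run is literally the
same (`HaltsFrom.exists_forall_cycle`), hence rejects again.

But there the answer is yes even in the stronger reading (a). A machine tailored to `N` fetches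
documents `0, …, N`, compares them with the expected cycle, prints a constant word if all agree and
diverges otherwise. It is correct wherever it halts: those `N + 1` documents contain the seed and
are closed under links, so they determine the result whatever else the Web contains
(`ContainsCycle.encodesSet`).

The chain lies outside the larger problem and the cycles inside the smaller one, so both readings,
and anything between them, fall together. The encoding of the input plays no role, since the same
input is used on all these Webs. Most of the work lies in showing that the encodings can be parsed
unambiguously and in running the tailored machine (`straightLine`) step by step. -/

namespace LinkedData

/-! ### Decoding -/

/-- The symbols of binary representations. -/
def Sym.IsDigit (a : Sym) : Prop := a = Sym.zero ∨ a = Sym.one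

theorem isDigit_of_mem_encNat {n : ℕ} {a : Sym} (h : a ∈ encNat n) : a.IsDigit := by
  simp only [encNat, List.mem_map] at h
  obtain ⟨b, -, rfl⟩ := h
  cases b <;> simp [Sym.IsDigit]

theorem encNat_injective : Function.Injective encNat := by
  intro m n h
  have h3 : m.bits = n.bits :=
    List.map_injective_iff.2 (fun a b hab => by cases a <;> cases b <;> simp_all) h
  apply Nat.eq_of_testBit_eq
  intro i
  rw [Nat.testBit_eq_inth, Nat.testBit_eq_inth, h3]

/-- Both factorizations cut the word at its first element that fails `p`. -/
theorem append_cons_cancel_of_not_mem {A : Type} {p : A → Prop} {l₁ l₂ r₁ r₂ : List A} {a b : A}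
    (h₁ : ∀ x ∈ l₁, p x) (h₂ : ∀ x ∈ l₂, p x) (ha : ¬ p a) (hb : ¬ p b)
    (h : l₁ ++ a :: r₁ = l₂ ++ b :: r₂) : l₁ = l₂ ∧ a = b ∧ r₁ = r₂ := by
  induction l₁ generalizing l₂ with
  | nil =>
    cases l₂ with
    | nil => simpa using h
    | cons y l₂ =>
      simp only [List.nil_append, List.cons_append, List.cons.injEq] at h
      exact absurd (h.1 ▸ h₂ y (by simp)) ha
  | cons x l₁ ih =>
    cases l₂ with
    | nil =>
      simp only [List.nil_append, List.cons_append, List.cons.injEq] at h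
      exact absurd (h.1 ▸ h₁ x (by simp)) hb
    | cons y l₂ =>
      simp only [List.cons_append, List.cons.injEq] at h
      obtain ⟨e1, e2⟩ := ih (fun z hz => h₁ z (by simp [hz])) (fun z hz => h₂ z (by simp [hz])) h.2
      exact ⟨by rw [h.1, e1], e2⟩

/-- Binary representations are not prefix-free (that of 0 is empty), so decoding relies on the
non-digit that follows. -/
theorem encNat_append_cons_cancel {m n : ℕ} {a b : Sym} {r s : List Sym} (ha : ¬ a.IsDigit)
    (hb : ¬ b.IsDigit) (h : encNat m ++ a :: r = encNat n ++ b :: s) :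
    m = n ∧ a = b ∧ r = s := by
  obtain ⟨h1, h2⟩ := append_cons_cancel_of_not_mem (p := Sym.IsDigit)
    (fun _ => isDigit_of_mem_encNat) (fun _ => isDigit_of_mem_encNat) ha hb h
  exact ⟨encNat_injective h1, h2⟩

theorem encURI_append_cons_cancel {u v : URI} {a b : Sym} {r s : List Sym} (ha : ¬ a.IsDigit)
    (hb : ¬ b.IsDigit) (h : encURI u ++ a :: r = encURI v ++ b :: s) :
    u = v ∧ a = b ∧ r = s := by
  simp only [encURI, List.cons_append, List.cons.injEq, true_and] at h
  obtain ⟨h1, h2⟩ := encNat_append_cons_cancel ha hb h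
  exact ⟨by cases u; cases v; simp_all, h2⟩

theorem encTerm_append_cons_cancel {x y : Term} {a b : Sym} {r s : List Sym} (ha : ¬ a.IsDigit)
    (hb : ¬ b.IsDigit) (h : encTerm x ++ a :: r = encTerm y ++ b :: s) :
    x = y ∧ a = b ∧ r = s := by
  rcases x with ⟨⟨i⟩⟩ | ⟨⟨i⟩⟩ | ⟨⟨i⟩⟩ <;> rcases y with ⟨⟨j⟩⟩ | ⟨⟨j⟩⟩ | ⟨⟨j⟩⟩ <;>
    simp only [encTerm, encURI, List.cons_append, List.cons.injEq, true_and, reduceCtorEq,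
      false_and] at h
  all_goals
    obtain ⟨h1, h2⟩ := encNat_append_cons_cancel ha hb h
    exact ⟨by rw [h1], h2⟩

theorem encTriple_append_cancel {t t' : Triple} {r s : List Sym}
    (h : encTriple t ++ r = encTriple t' ++ s) : t = t' ∧ r = s := by
  simp only [encTriple, List.append_assoc, List.cons_append, List.nil_append, List.cons.injEq,
    true_and] at h
  obtain ⟨h1, -, h⟩ := encTerm_append_cons_cancel (by simp [Sym.IsDigit]) (by simp [Sym.IsDigit]) h
  obtain ⟨h2, -, h⟩ := encURI_append_cons_cancel (by simp [Sym.IsDigit]) (by simp [Sym.IsDigit]) h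
  obtain ⟨h3, -, h⟩ := encTerm_append_cons_cancel (by simp [Sym.IsDigit]) (by simp [Sym.IsDigit]) h
  exact ⟨Triple.ext h1 h2 h3, h⟩

theorem encTriples_singleton (t : Triple) :
    encTriples {t} = [Sym.llang] ++ encTriple t ++ [Sym.rrang] := by
  simp [encTriples, List.intercalate]

/-- The closing bracket makes the encoding self-delimiting: an empty set closes where a triple
should open, and a set with two or more triples has a comma where the singleton closes. -/
theorem eq_singleton_of_encTriples_append {T : Finset Triple} {t : Triple} {r s : List Sym}
    (h : encTriples {t} ++ r = encTriples T ++ s) : T = {t} ∧ r = s := by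
  rw [encTriples_singleton] at h
  rcases hT : T.sort (· ≤ ·) with _ | ⟨a, _ | ⟨b, l⟩⟩
  · simp [encTriples, hT, List.intercalate, encTriple] at h
  · simp only [encTriples, hT, List.intercalate, List.map_cons, List.map_nil,
      List.intersperse_singleton, List.flatten_cons, List.flatten_nil, List.append_nil,
      List.append_assoc, List.cons_append, List.nil_append, List.cons.injEq, true_and] at h
    obtain ⟨h1, h2⟩ := encTriple_append_cancel h
    refine ⟨?_, by simpa using h2⟩
    ext x
    rw [← Finset.mem_sort (· ≤ ·), hT, h1]
    simp
  · simp only [encTriples, hT, List.intercalate, List.map_cons,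
      List.intersperse_cons_cons, List.flatten_cons,
      List.append_assoc, List.cons_append, List.nil_append, List.cons.injEq, true_and] at h
    simpa using (encTriple_append_cancel h).2

theorem eq_of_encURI_suffix {E : Type} {u v : URI} {w : List (Option (Sym ⊕ E))}
    (hu : (encURI u).map (fun a => some (Sum.inl a)) <:+ w)
    (hv : (encURI v).map (fun a => some (Sum.inl a)) <:+ w) : u = v := by
  obtain ⟨p, hp⟩ := hu
  obtain ⟨q, hq⟩ := hv
  -- Read from the right, the digits end at the first `kindU`.
  have h := congrArg List.reverse (hp.trans hq.symm)
  simp only [encURI, List.map_cons, List.reverse_append, List.reverse_cons, List.append_assoc,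
    List.cons_append, List.nil_append] at h
  have hd : ∀ n : ℕ, ∀ x ∈ ((encNat n).map (fun a => some (Sum.inl a : Sym ⊕ E))).reverse,
      ∃ a : Sym, a.IsDigit ∧ x = some (Sum.inl a) := by
    intro n x hx
    simp only [List.mem_reverse, List.mem_map] at hx
    obtain ⟨a, ha, rfl⟩ := hx
    exact ⟨a, isDigit_of_mem_encNat ha, rfl⟩
  have hk : ¬ ∃ a : Sym, a.IsDigit ∧ some (Sum.inl Sym.kindU : Sym ⊕ E) = some (Sum.inl a) := by
    rintro ⟨a, ha, hk⟩
    simp only [Option.some.injEq, Sum.inl.injEq] at hk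
    subst hk
    simp [Sym.IsDigit] at ha
  have h1 := (append_cons_cancel_of_not_mem (hd _) (hd _) hk hk h).1
  have h2 := encNat_injective
    (List.map_injective_iff.2 (fun a b hab => by simpa using hab) (List.reverse_injective h1))
  cases u; cases v; simp_all

/-! ### The Web tape -/

theorem Web.exists_encPrefix_eq_append_sharp (W : Web) (n : ℕ) :
    ∃ l, W.encPrefix n = l ++ [Sym.sharp] := by
  induction n with
  | zero => exact ⟨[], rfl⟩
  | succ n ih =>
    obtain ⟨l, hl⟩ := ih
    have h : W.encPrefix (n + 1) = W.encPrefix n ++ (match W.adoc ⟨n⟩ with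
        | some d => encURI ⟨n⟩ ++ W.encDoc d ++ [Sym.sharp]
        | none => []) := by
      simp only [Web.encPrefix, List.range_succ, List.flatMap_append, List.flatMap_singleton,
        List.cons_append]
    rw [h]
    cases W.adoc ⟨n⟩ with
    | none => exact ⟨l, by simp [hl]⟩
    | some d => exact ⟨W.encPrefix n ++ (encURI ⟨n⟩ ++ W.encDoc d), by simp⟩

/-- The opening `#` of the entry for `u` is the last symbol of the prefix before it. Hence the Web
tape condition in `LookupSucceeds` holds automatically. -/
theorem Web.encContains_of_adoc {W : Web} {u : URI} {d : W.Doc} (h : W.adoc u = some d) :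
    W.EncContains ([Sym.sharp] ++ encURI u ++ W.encDoc d ++ [Sym.sharp]) := by
  obtain ⟨l, hl⟩ := W.exists_encPrefix_eq_append_sharp u.idx
  refine ⟨u.idx + 1, l, [], ?_⟩
  have h' : W.encPrefix (u.idx + 1) =
      W.encPrefix u.idx ++ (encURI u ++ W.encDoc d ++ [Sym.sharp]) := by
    simp only [Web.encPrefix, List.range_succ, List.flatMap_append, List.flatMap_singleton,
      List.cons_append, h]
  rw [h', hl]
  simp

namespace LDMachine

theorem LookupSucceeds.lookup_eq {E : Type} {W : Web} {w : List (Option (Sym ⊕ E))} {x : List Sym}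
    (h : LookupSucceeds W w x) : lookup W w = x := by
  have h' : ∃ x, LookupSucceeds W w x := ⟨x, h⟩
  rw [lookup, dif_pos h']
  exact h'.choose_spec.unique h

theorem lookup_of_adoc_eq_some {E : Type} {W : Web} {w : List (Option (Sym ⊕ E))} {u : URI}
    {d : W.Doc} (hw : (encURI u).map (fun a => some (Sum.inl a)) <:+ w) (h : W.adoc u = some d) :
    lookup W w = W.encDoc d ++ [Sym.sharp] :=
  LookupSucceeds.lookup_eq ⟨u, d, hw, h, Web.encContains_of_adoc h, rfl⟩

theorem lookup_of_adoc_eq_none {E : Type} {W : Web} {w : List (Option (Sym ⊕ E))} {u : URI}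
    (hw : (encURI u).map (fun a => some (Sum.inl a)) <:+ w) (h : W.adoc u = none) :
    lookup W w = [Sym.sharp] := by
  rw [lookup, dif_neg]
  rintro ⟨x, v, d, hv, hd, -⟩
  rw [← eq_of_encURI_suffix hw hv, h] at hd
  cases hd

theorem lookup_of_no_suffix {E : Type} {W : Web} {w : List (Option (Sym ⊕ E))}
    (hw : ∀ u : URI, ¬ (encURI u).map (fun a => some (Sum.inl a)) <:+ w) :
    lookup W w = [Sym.sharp] := by
  rw [lookup, dif_neg]
  rintro ⟨x, v, d, hv, -⟩
  exact hw v hv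

end LDMachine

/-! ### Webs in which every document contains a single link -/

/-- The triple all of whose components are the URI with index `j`. -/
def linkTriple (j : ℕ) : Triple where
  s := .uri ⟨j⟩
  p := ⟨j⟩
  o := .uri ⟨j⟩
  s_not_lit := by simp

theorem terms_linkTriple (j : ℕ) : (linkTriple j).terms = {Term.uri ⟨j⟩} := by
  simp [linkTriple, Triple.terms]

theorem mem_uris_linkTriple {j : ℕ} {u : URI} : u ∈ (linkTriple j).uris ↔ u = ⟨j⟩ := by
  simp [Triple.uris, terms_linkTriple]

/-- The Web whose `i`-th document contains a single link, to the document `g i`. -/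
def linkWeb (g : ℕ → ℕ) : Web where
  Doc := ℕ
  countable_doc := inferInstance
  data i := {linkTriple (g i)}
  bnodes_disjoint := by
    intro d₁ d₂ _ t₁ h₁ t₂ _ b h
    rw [Finset.mem_singleton] at h₁
    subst h₁
    simp [terms_linkTriple] at h
  adoc u := some u.idx
  adoc_surjective d := ⟨⟨d⟩, rfl⟩

/-- The criterion that follows all links. -/
def Criterion.all : Criterion where
  toFun _ _ _ := true
  computable := ⟨fun _ => true, Computable.const true, fun _ _ _ => rfl⟩

theorem mem_allData_reachablePart {W : Web} {S : Finset URI} {c : Criterion} {P : Expr}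
    {t : Triple} :
    t ∈ (reachablePart W S c P).allData ↔ ∃ d, Reachable W S c P d ∧ t ∈ W.data d := by
  constructor
  · rintro ⟨⟨d, hd⟩, ht⟩
    exact ⟨d, hd, ht⟩
  · rintro ⟨d, hd, ht⟩
    exact ⟨⟨d, hd⟩, ht⟩

theorem reachable_linkWeb_succ (P : Expr) (i : ℕ) :
    Reachable (linkWeb Nat.succ) {⟨0⟩} Criterion.all P i := by
  induction i with
  | zero => exact .seed ⟨0⟩ _ (by simp) rfl
  | succ i ih =>
    exact .link i _ (linkTriple (i + 1)) ⟨i + 1⟩ ih (Finset.mem_singleton_self _)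
      (mem_uris_linkTriple.2 rfl) rfl rfl

theorem Criterion.not_ensuresFiniteness_all : ¬ Criterion.all.EnsuresFiniteness := by
  intro h
  have hf := h (linkWeb Nat.succ) {⟨0⟩} (.tp ⟨.inl ⟨0⟩, .inl ⟨0⟩, .inl ⟨0⟩⟩)
  have : Finite ℕ := @Finite.of_injective _ _ hf
    (fun i : ℕ => (⟨i, reachable_linkWeb_succ _ i⟩ :
      (reachablePart (linkWeb Nat.succ) {⟨0⟩} Criterion.all
        (.tp ⟨.inl ⟨0⟩, .inl ⟨0⟩, .inl ⟨0⟩⟩)).Doc))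
    (fun i j hij => congrArg Subtype.val hij)
  exact not_finite ℕ

/-- The successor function, except that `N` is mapped to `0`. -/
def cycle (N : ℕ) : ℕ → ℕ := Function.update Nat.succ N 0

/-- `W` contains the first `N + 1` documents of `linkWeb (cycle N)`. -/
def ContainsCycle (W : Web) (N : ℕ) : Prop :=
  ∀ i ≤ N, ∃ d, W.adoc ⟨i⟩ = some d ∧ W.data d = {linkTriple (cycle N i)}

theorem cycle_le {N i : ℕ} (h : i ≤ N) : cycle N i ≤ N := by
  rcases eq_or_ne i N with rfl | hi
  · simp [cycle]
  · simp only [cycle, Function.update_of_ne hi]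
    omega

theorem containsCycle_linkWeb (N : ℕ) : ContainsCycle (linkWeb (cycle N)) N :=
  fun i _ => ⟨i, rfl, rfl⟩

theorem ContainsCycle.reachable {W : Web} {N : ℕ} (h : ContainsCycle W N) (P : Expr) {i : ℕ}
    (hi : i ≤ N) {d : W.Doc} (hd : W.adoc ⟨i⟩ = some d) :
    Reachable W {⟨0⟩} Criterion.all P d := by
  induction i generalizing d with
  | zero => exact .seed ⟨0⟩ d (by simp) hd
  | succ i ih =>
    obtain ⟨d', hd', hdata⟩ := h i (by omega)
    refine .link d' d (linkTriple (i + 1)) ⟨i + 1⟩ (ih (by omega) hd') ?_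
      (mem_uris_linkTriple.2 rfl) rfl hd
    -- Since `i + 1 ≤ N`, the redirected link of document `N` is never used.
    simp [hdata, cycle, Function.update_of_ne (show i ≠ N by omega)]

/-- The documents `0, …, N` contain the seed and are closed under links, because `cycle N` maps `{0,
…, N}` into itself. The rest of `W` is arbitrary. -/
theorem ContainsCycle.exists_of_reachable {W : Web} {N : ℕ} (h : ContainsCycle W N) {P : Expr}
    {d : W.Doc} (hd : Reachable W {⟨0⟩} Criterion.all P d) :
    ∃ i ≤ N, W.adoc ⟨i⟩ = some d := by
  induction hd with
  | seed u d hu hd =>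
    rw [Finset.mem_singleton] at hu
    exact ⟨0, by omega, hu ▸ hd⟩
  | link d' d t u _ ht hu _ hd ih =>
    obtain ⟨i, hi, hd'⟩ := ih
    obtain ⟨e, he, hdata⟩ := h i hi
    obtain rfl : d' = e := by simpa [hd'] using he
    rw [hdata, Finset.mem_singleton] at ht
    subst ht
    rw [mem_uris_linkTriple] at hu
    exact ⟨_, cycle_le hi, hu ▸ hd⟩

theorem ContainsCycle.allData_eq {W : Web} {N : ℕ} (h : ContainsCycle W N) (P : Expr) :
    (reachablePart W {⟨0⟩} Criterion.all P).allData = linkTriple '' {j | j ≤ N} := by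
  ext t
  rw [mem_allData_reachablePart]
  constructor
  · rintro ⟨d, hd, ht⟩
    obtain ⟨i, hi, hid⟩ := h.exists_of_reachable hd
    obtain ⟨e, he, hdata⟩ := h i hi
    obtain rfl : d = e := by simpa [hid] using he
    rw [hdata, Finset.mem_singleton] at ht
    exact ⟨_, cycle_le hi, ht.symm⟩
  · rintro ⟨j, hj, rfl⟩
    -- `cycle N` permutes `{0, …, N}`: the preimage of 0 is `N`, that of `j + 1` is `j`.
    obtain ⟨i, hi, hij⟩ : ∃ i ≤ N, cycle N i = j := by
      rcases j with _ | j
      · exact ⟨N, le_rfl, by simp [cycle]⟩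
      · simp only [Set.mem_ofPred_eq] at hj
        exact ⟨j, by omega, by simp [cycle, Function.update_of_ne (show j ≠ N by omega)]⟩
    obtain ⟨d, hd, hdata⟩ := h i hi
    exact ⟨d, h.reachable P hi hd, by simp [hdata, hij]⟩

/-! ### The query -/

/-- The expression that consists of the triple pattern `(?x, ?x, ?x)`. -/
def diagonalExpr : Expr := .tp ⟨.inl ⟨0⟩, .inl ⟨0⟩, .inl ⟨0⟩⟩

/-- The valuation that maps `?x` to the URI with index `j`. -/
def uriValuation (j : ℕ) : Valuation := fun v => if v = ⟨0⟩ then some (.uri ⟨j⟩) else none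

theorem uriValuation_injective : Function.Injective uriValuation := by
  intro i j h
  simpa [uriValuation] using congrFun h ⟨0⟩

theorem eval_diagonalExpr (A : Set ℕ) :
    diagonalExpr.eval (linkTriple '' A) = uriValuation '' A := by
  ext μ
  simp only [diagonalExpr, Expr.eval, Set.mem_ofPred_eq]
  constructor
  · rintro ⟨hdom, -, ⟨j, hj, rfl⟩, h, -⟩
    refine ⟨j, hj, funext fun v => ?_⟩
    by_cases hv : v = ⟨0⟩
    · subst hv
      simpa [uriValuation, linkTriple] using h.symm
    · have hv' : v ∉ μ.dom := by
        rw [hdom]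
        simpa [TriplePattern.vars, eq_comm] using hv
      have hμ : μ v = none := by simpa [Valuation.dom] using hv'
      simp [uriValuation, hv, hμ]
  · rintro ⟨j, hj, rfl⟩
    refine ⟨?_, _, ⟨j, hj, rfl⟩, ?_⟩
    · ext v
      simp only [Valuation.dom, uriValuation, TriplePattern.vars, Set.mem_ofPred_eq, Sum.inl.injEq,
        or_self]
      by_cases hv : v = ⟨0⟩ <;> simp [hv, eq_comm]
    · simp [TriplePattern.Instantiates, uriValuation, linkTriple]

/-- The encoding of `uriValuation j`. -/
def encUriValuation (j : ℕ) : List Sym :=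
  [Sym.llang] ++ (encVar ⟨0⟩ ++ [Sym.arrow] ++ encURI ⟨j⟩) ++ [Sym.rrang]

theorem encodesValuation_uriValuation (j : ℕ) :
    EncodesValuation (uriValuation j) (encUriValuation j) := by
  refine ⟨[(⟨0⟩, .uri ⟨j⟩)], by simp, fun v a => ?_, ?_⟩
  · by_cases hv : v = ⟨0⟩ <;> simp [uriValuation, hv, eq_comm]
  · simp [encUriValuation, List.intercalate, encTerm]

/-- An encoding of the valuations that map `?x` to a URI with index at most `N`. -/
def encUriValuations (N : ℕ) : List Sym := (List.range (N + 1)).flatMap encUriValuation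

theorem encodesSet_uriValuation (N : ℕ) :
    EncodesSet (uriValuation '' {j | j ≤ N}) (encUriValuations N) := by
  refine ⟨(List.range (N + 1)).map uriValuation,
    List.nodup_range.map uriValuation_injective, fun μ => ?_,
    (List.range (N + 1)).map encUriValuation, ?_, by simp [encUriValuations, List.flatMap_def]⟩
  · simp
  · rw [List.forall₂_map_left_iff, List.forall₂_map_right_iff, List.forall₂_same]
    exact fun j _ => encodesValuation_uriValuation j

theorem EncodesSet.finite {Ω : Set Valuation} {w : List Sym} (h : EncodesSet Ω w) : Ω.Finite := by
  obtain ⟨l, -, hl, -⟩ := h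
  exact (List.finite_toSet l).subset fun μ hμ => (hl μ).2 hμ

theorem ContainsCycle.encodesSet {W : Web} {N : ℕ} (h : ContainsCycle W N) :
    EncodesSet (reachQuery diagonalExpr {⟨0⟩} Criterion.all W) (encUriValuations N) := by
  rw [reachQuery, h.allData_eq, eval_diagonalExpr]
  exact encodesSet_uriValuation N

theorem infinite_reachQuery_linkWeb_succ :
    (reachQuery diagonalExpr {⟨0⟩} Criterion.all (linkWeb Nat.succ)).Infinite := by
  have hG : (reachablePart (linkWeb Nat.succ) {⟨0⟩} Criterion.all diagonalExpr).allData =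
      linkTriple '' Set.range Nat.succ := by
    ext t
    rw [mem_allData_reachablePart]
    constructor
    · rintro ⟨d, -, ht⟩
      exact ⟨_, ⟨d, rfl⟩, (Finset.mem_singleton.1 ht).symm⟩
    · rintro ⟨_, ⟨d, rfl⟩, rfl⟩
      exact ⟨d, reachable_linkWeb_succ _ d, Finset.mem_singleton_self _⟩
  rw [reachQuery, hG, eval_diagonalExpr]
  exact (Set.infinite_range_of_injective Nat.succ_injective).image uriValuation_injective.injOn

/-! ### Halting computations -/

namespace LDMachine

/-- The computation that starts in the configuration `C` halts in the configuration `C'`. -/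
def HaltsFrom (M : LDMachine) (W : Web) (C C' : M.Config) : Prop :=
  Relation.ReflTransGen (fun C₁ C₂ => M.step W C₁ = some C₂) C C' ∧ M.step W C' = none

variable {M : LDMachine} {W : Web} {C C₁ C₂ : M.Config}

/-- The computation is deterministic, so its first step can be stripped off. As an equivalence, this
also transports divergence. -/
theorem haltsFrom_iff_of_step (h : M.step W C = some C₁) :
    M.HaltsFrom W C C₂ ↔ M.HaltsFrom W C₁ C₂ := by
  constructor
  · rintro ⟨h1, h2⟩
    rcases h1.cases_head with rfl | ⟨C', h3, h4⟩
    · rw [h] at h2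
      cases h2
    · rw [h] at h3
      cases h3
      exact ⟨h4, h2⟩
  · rintro ⟨h1, h2⟩
    exact ⟨.head h h1, h2⟩

theorem haltsFrom_iff_of_step_eq_none (h : M.step W C = none) : M.HaltsFrom W C C₁ ↔ C₁ = C := by
  constructor
  · rintro ⟨h1, h2⟩
    rcases h1.cases_head with rfl | ⟨C', h3, h4⟩
    · rfl
    · rw [h] at h3
      cases h3
  · rintro rfl
    exact ⟨.refl, h⟩

theorem not_haltsFrom_of_invariant (I : M.Config → Prop)
    (hI : ∀ C, I C → ∃ C', M.step W C = some C' ∧ I C') (hC : I C) : ¬ M.HaltsFrom W C C₁ := by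
  rintro ⟨h1, h2⟩
  have hC₁ : I C₁ := by
    clear h2
    induction h1 with
    | refl => exact hC
    | tail _ h3 ih =>
      obtain ⟨C', h4, h5⟩ := hI _ ih
      rw [h3, Option.some.injEq] at h4
      exact h4 ▸ h5
  obtain ⟨C', h4, -⟩ := hI _ hC₁
  rw [h2] at h4
  cases h4

theorem HaltsFrom.unique (h₁ : M.HaltsFrom W C C₁) (h₂ : M.HaltsFrom W C C₂) : C₁ = C₂ := by
  obtain ⟨h, hn⟩ := h₁
  induction h using Relation.ReflTransGen.head_induction_on with
  | refl => exact ((haltsFrom_iff_of_step_eq_none hn).1 h₂).symm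
  | head h3 _ ih => exact ih ((haltsFrom_iff_of_step h3).1 h₂)

/-! ### Halting computations inspect only finitely many documents -/

/-- A lookup concerns the one URI in which `w` ends, and the two Webs differ only in document `N`.
-/
theorem exists_forall_lookup_cycle_eq {E : Type} (w : List (Option (Sym ⊕ E))) :
    ∃ B, ∀ N ≥ B, lookup (linkWeb (cycle N)) w = lookup (linkWeb Nat.succ) w := by
  by_cases h : ∃ u : URI, (encURI u).map (fun a => some (Sum.inl a)) <:+ w
  · obtain ⟨u, hu⟩ := h
    refine ⟨u.idx + 1, fun N hN => ?_⟩
    rw [lookup_of_adoc_eq_some (W := linkWeb (cycle N)) hu rfl,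
      lookup_of_adoc_eq_some (W := linkWeb Nat.succ) hu rfl]
    simp only [Web.encDoc, linkWeb, cycle, Function.update_of_ne (show u.idx ≠ N by omega)]
  · push Not at h
    exact ⟨0, fun N _ => by rw [lookup_of_no_suffix h, lookup_of_no_suffix h]⟩

theorem exists_forall_step_cycle_eq (C : M.Config) :
    ∃ B, ∀ N ≥ B, M.step (linkWeb (cycle N)) C = M.step (linkWeb Nat.succ) C := by
  obtain ⟨B, hB⟩ := exists_forall_lookup_cycle_eq C.link.word
  exact ⟨B, fun N hN => by simp only [step, expandTape, hB N hN]⟩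

/-- The run has finitely many steps, so the largest of their bounds serves for all. -/
theorem HaltsFrom.exists_forall_cycle (h : M.HaltsFrom (linkWeb Nat.succ) C C₁) :
    ∃ B, ∀ N ≥ B, M.HaltsFrom (linkWeb (cycle N)) C C₁ := by
  obtain ⟨h, hn⟩ := h
  induction h using Relation.ReflTransGen.head_induction_on with
  | refl =>
    obtain ⟨B, hB⟩ := exists_forall_step_cycle_eq C₁
    exact ⟨B, fun N hN => ⟨.refl, (hB N hN).trans hn⟩⟩
  | @head C C' h3 _ ih =>
    obtain ⟨B, hB⟩ := ih
    obtain ⟨B', hB'⟩ := exists_forall_step_cycle_eq C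
    refine ⟨max B B', fun N hN => ?_⟩
    rw [haltsFrom_iff_of_step ((hB' N (le_of_max_le_right hN)).trans h3)]
    exact hB N (le_of_max_le_left hN)

end LDMachine

/-! ### Straight-line programs -/

/-- Instructions: write a symbol on the link traversal tape, call the expand procedure, check the
symbol under the head of the link traversal tape, append a symbol to the output. -/
inductive Instr where
  | write (a : Sym)
  | expand
  | check (a : Sym)
  | out (a : Sym)

theorem finite_suffixes {A : Type} (l : List A) : Finite {l' : List A // l' <:+ l} := by
  have : Finite {l' : List A // l' ∈ l.tails} := (List.finite_toSet l.tails).to_subtype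
  simpa only [List.mem_tails] using this

open Classical in
/-- The machine that executes a list of instructions, and runs forever if a check fails. Its states
are the expand state `none`, the diverging state `some none` and the remaining instructions. Before a
call of the expand procedure the return address is written on the work tape. -/
noncomputable def straightLine (prog : List Instr) : LDMachine where
  State := Option (Option {l : List Instr // l <:+ prog})
  finite_state := by
    have := finite_suffixes prog
    infer_instance
  Extra := {l : List Instr // l <:+ prog}
  finite_extra := finite_suffixes prog
  start := some (some ⟨prog, List.suffix_rfl⟩)
  expand := none
  accepting := ∅
  rejecting := ∅
  disjoint := disjoint_bot_left
  trans q _ w k :=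
    match q with
    | none =>
      match w with
      | some (.inr l) => some ⟨some (some l), none, none, none, k, none, none⟩
      | _ => none
    | some none => some ⟨some none, none, w, none, k, none, none⟩
    | some (some ⟨[], _⟩) => none
    | some (some ⟨.write a :: l, h⟩) =>
      some ⟨some (some ⟨l, (List.suffix_cons _ l).trans h⟩), none, w, none, some (.inl a),
        some .right, none⟩
    | some (some ⟨.expand :: l, h⟩) =>
      some ⟨none, none, some (.inr ⟨l, (List.suffix_cons _ l).trans h⟩), none, k, none, none⟩
    | some (some ⟨.check a :: l, h⟩) =>
      if k = some (.inl a) then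
        some ⟨some (some ⟨l, (List.suffix_cons _ l).trans h⟩), none, w, none, k, some .right, none⟩
      else some ⟨some none, none, w, none, k, none, none⟩
    | some (some ⟨.out a :: l, h⟩) =>
      some ⟨some (some ⟨l, (List.suffix_cons _ l).trans h⟩), none, w, none, k, none, some a⟩

namespace straightLine

open LDMachine

/-- The configuration in which the instructions `l` remain. -/
def config {prog : List Instr} (l : List Instr) (h : l <:+ prog)
    (T : RightTape (straightLine prog).Alphabet) (o : List Sym) : (straightLine prog).Config where
  state := some (some ⟨l, h⟩)
  input := Turing.Tape.mk₁ []
  work := Turing.Tape.mk₁ []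
  link := T
  output := o

/-- The tape with the word `v` and the head at position `p`. -/
def tape (prog : List Instr) (v : List Sym) (p : ℕ) : RightTape (straightLine prog).Alphabet where
  cells := v.map fun a => some (Sum.inl a)
  pos := p

variable {prog l : List Instr} {W : Web} {v x : List Sym} {o : List Sym}
  {C : (straightLine prog).Config}

theorem write_tape_length (v : List Sym) (a : Option (straightLine prog).Alphabet) :
    (tape prog v v.length).write a = ⟨v.map (fun b => some (Sum.inl b)) ++ [a], v.length⟩ := by
  simp [tape, RightTape.write]

/-- Every transition writes, so leaving a cell unchanged means writing back what was read. Past the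
end of the word this would add a blank cell. -/
theorem write_read_tape {p : ℕ} (hp : p < v.length) :
    (tape prog v p).write (tape prog v p).read = tape prog v p := by
  have h : p < (tape prog v p).cells.length := by simpa [tape] using hp
  have h' : (tape prog v p).read = (tape prog v p).cells[p] := List.getD_eq_getElem _ _ h
  rw [h', RightTape.write]
  simp only [tape, List.length_map, Nat.sub_eq_zero_of_le (Nat.succ_le_of_lt hp),
    List.replicate_zero, List.append_nil, List.set_getElem_self]

theorem read_tape_append (v x : List Sym) :
    (tape prog (v ++ x) v.length).read = x.head?.map Sum.inl := by
  cases x <;> simp [tape, RightTape.read]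

theorem word_append_blank (v : List Sym) (p : ℕ) :
    (⟨v.map (fun b => some (Sum.inl b)) ++ [none], p⟩ :
      RightTape (straightLine prog).Alphabet).word = v.map fun b => some (Sum.inl b) := by
  have h : (v.map fun b => (some (Sum.inl b) : Option (straightLine prog).Alphabet)).rdropWhile
      (fun a => decide (a = none)) = v.map fun b => some (Sum.inl b) := by
    rw [List.rdropWhile_eq_self_iff]
    intro hl
    rw [List.getLast_map]
    simp
  simp only [RightTape.word]
  rw [List.rdropWhile_concat_pos _ _ _ (by simp)]
  convert h

theorem write_tape_append_cons (v x : List Sym) (a : Sym) :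
    (tape prog (v ++ a :: x) v.length).write (some (.inl a)) =
      tape prog (v ++ a :: x) v.length := by
  have h := write_read_tape (prog := prog) (v := v ++ a :: x) (p := v.length) (by simp)
  rwa [read_tape_append] at h

theorem haltsFrom_write (a : List Sym) (h : a.map Instr.write ++ l <:+ prog) :
    (straightLine prog).HaltsFrom W (config _ h (tape prog v v.length) o) C ↔
      (straightLine prog).HaltsFrom W (config l ((List.suffix_append _ l).trans h)
        (tape prog (v ++ a) (v ++ a).length) o) C := by
  induction a generalizing v with
  | nil => simp
  | cons b a ih =>
    have hs : (straightLine prog).step W (config _ h (tape prog v v.length) o) =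
        some (config (a.map Instr.write ++ l) ((List.suffix_cons _ _).trans h)
          (tape prog (v ++ [b]) (v ++ [b]).length) o) := by
      rw [step, if_neg (by simp [config, straightLine])]
      simp only [ordinaryStep, config, straightLine, List.map_cons, List.cons_append,
        Option.map_some, moveTape, Option.toList_none, List.append_nil]
      congr 2
      refine congrArg (RightTape.move · (some .right)) (write_tape_length v _) |>.trans ?_
      simp [RightTape.move, tape]
      rfl
    rw [haltsFrom_iff_of_step hs, ih]
    simp

/-- The head stays at `v.length`, the first symbol of the answer, where the subsequent checks begin.
-/
theorem haltsFrom_expand (h : Instr.expand :: l <:+ prog) :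
    (straightLine prog).HaltsFrom W (config _ h (tape prog v v.length) o) C ↔
      (straightLine prog).HaltsFrom W (config l ((List.suffix_cons _ l).trans h)
        (tape prog (v ++ lookup W (tape prog v 0).cells) v.length) o) C := by
  let C₁ : (straightLine prog).Config :=
    { state := none
      input := Turing.Tape.mk₁ []
      work := (Turing.Tape.mk₁ []).write (some (.inr ⟨l, (List.suffix_cons _ l).trans h⟩))
      -- Entering the expand state writes a blank just past the word; `RightTape.word` discards it
      -- before the answer is appended.
      link := ⟨(tape prog v 0).cells ++ [none], v.length⟩
      output := o }
  have h₁ : (straightLine prog).step W (config _ h (tape prog v v.length) o) = some C₁ := by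
    rw [step, if_neg (by simp [config, straightLine])]
    simp only [ordinaryStep, config, straightLine,
      Option.map_some, moveTape, Option.toList_none, List.append_nil, C₁]
    congr 2
    have hr : (tape prog v v.length).read = none := by simp [tape, RightTape.read]
    refine (congrArg (RightTape.write (tape prog v v.length)) hr).trans (write_tape_length v _)
  have he : (straightLine prog).expandTape W C₁.link =
      tape prog (v ++ lookup W (tape prog v 0).cells) v.length := by
    have hw : C₁.link.word = (tape prog v 0).cells := word_append_blank v v.length
    rw [expandTape, hw]
    simp only [RightTape.append, hw]
    simp [tape, C₁]
  -- A nonempty answer puts the head on the word, so `write_read_tape` applies.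
  have hne : lookup W (tape prog v 0).cells ≠ [] := by
    rw [lookup]
    split_ifs with hx
    · obtain ⟨u, d, -, -, -, hd⟩ := hx.choose_spec
      rw [hd]
      simp
    · simp
  have h₂ : (straightLine prog).step W C₁ = some (config l ((List.suffix_cons _ l).trans h)
        (tape prog (v ++ lookup W (tape prog v 0).cells) v.length) o) := by
    rw [step, if_pos (show C₁.state = (straightLine prog).expand from rfl), he]
    have hw := write_read_tape (prog := prog) (v := v ++ lookup W (tape prog v 0).cells)
      (p := v.length) (by simpa [List.length_pos_iff] using hne)
    simp only [ordinaryStep, straightLine, C₁, Turing.Tape.write, Option.map_some, moveTape,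
      Option.toList_none, List.append_nil, config, RightTape.move]
    congr 2
  rw [haltsFrom_iff_of_step h₁, haltsFrom_iff_of_step h₂]

theorem not_haltsFrom_of_state_eq_diverge {C₁ : (straightLine prog).Config}
    (h : C₁.state = some none) : ¬ (straightLine prog).HaltsFrom W C₁ C := by
  refine not_haltsFrom_of_invariant (fun C => C.state = some none) (fun C hC => ?_) h
  rw [step, if_neg (by simp [hC, straightLine]), ordinaryStep, hC]
  exact ⟨_, rfl, rfl⟩

theorem haltsFrom_check (a : List Sym) (h : a.map Instr.check ++ l <:+ prog) :
    (straightLine prog).HaltsFrom W (config _ h (tape prog (v ++ x) v.length) o) C ↔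
      a <+: x ∧ (straightLine prog).HaltsFrom W (config l ((List.suffix_append _ l).trans h)
        (tape prog (v ++ x) (v ++ a).length) o) C := by
  induction a generalizing v x with
  | nil => simp
  | cons b a ih =>
    by_cases hx : x.head? = some b
    · obtain ⟨y, rfl⟩ : ∃ y, x = b :: y := by
        cases x with
        | nil => simp at hx
        | cons c y => exact ⟨y, by simpa using hx⟩
      have hr := read_tape_append (prog := prog) v (b :: y)
      have hs : (straightLine prog).step W (config _ h (tape prog (v ++ b :: y) v.length) o) =
          some (config (a.map Instr.check ++ l) ((List.suffix_cons _ _).trans h)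
            (tape prog (v ++ [b] ++ y) (v ++ [b]).length) o) := by
        rw [step, if_neg (by simp [config, straightLine])]
        simp only [ordinaryStep, config, hr]
        simp only [straightLine, List.map_cons, List.cons_append, List.head?_cons, Option.map_some,
          if_true, moveTape, Option.toList_none, List.append_nil]
        congr 2
        refine congrArg (RightTape.move · (some .right)) (write_tape_append_cons v y b) |>.trans ?_
        simp [RightTape.move, tape]
      rw [haltsFrom_iff_of_step hs, ih]
      simp
    · have hr := read_tape_append (prog := prog) v x
      have hn : (x.head?.map Sum.inl : Option (straightLine prog).Alphabet) ≠ some (.inl b) := by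
        cases x <;> simp_all
      obtain ⟨C₁, hs, hC₁⟩ : ∃ C₁, (straightLine prog).step W
          (config _ h (tape prog (v ++ x) v.length) o) = some C₁ ∧ C₁.state = some none := by
        rw [step, if_neg (by simp [config, straightLine])]
        simp only [ordinaryStep, config, hr]
        simp only [straightLine, List.map_cons, List.cons_append]
        exact ⟨_, congrArg (Option.map _) (if_neg hn), rfl⟩
      rw [haltsFrom_iff_of_step hs]
      refine iff_of_false (not_haltsFrom_of_state_eq_diverge hC₁) ?_
      rintro ⟨⟨y, rfl⟩, -⟩
      simp at hx

theorem exists_haltsFrom_out (a : List Sym) (h : a.map Instr.out <:+ prog)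
    (T : RightTape (straightLine prog).Alphabet) :
    ∃ C₁, C₁.output = o ++ a ∧
      ∀ C, (straightLine prog).HaltsFrom W (config _ h T o) C ↔ C = C₁ := by
  induction a generalizing T o with
  | nil =>
    refine ⟨config _ h T o, by simp [config], fun C => haltsFrom_iff_of_step_eq_none ?_⟩
    rw [step, if_neg (by simp [config, straightLine])]
    rfl
  | cons b a ih =>
    have hs : (straightLine prog).step W (config _ h T o) = some (config (a.map Instr.out)
        ((List.suffix_cons _ _).trans h) (T.write T.read) (o ++ [b])) := by
      rw [step, if_neg (by simp [config, straightLine])]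
      simp only [ordinaryStep, config, straightLine, List.map_cons, Option.map_some,
        moveTape, Option.toList_some]
      rfl
    obtain ⟨C₁, h₁, h₂⟩ := ih (o := o ++ [b]) ((List.suffix_cons _ _).trans h) (T.write T.read)
    exact ⟨C₁, by simpa using h₁, fun C => by rw [haltsFrom_iff_of_step hs, h₂]⟩

/-- Look up the URI `u` and check that its document contains the triple `t` only. -/
noncomputable def fetch (u : URI) (t : Triple) : List Instr :=
  (encURI u).map .write ++ .expand :: (encTriples {t} ++ [Sym.sharp]).map .check

/-- A failed lookup returns only `#`, which fails the first check. After a successful one, the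
checks compare a prefix, and self-delimitation turns this into equality of the data. -/
theorem haltsFrom_fetch (u : URI) (t : Triple) (h : fetch u t ++ l <:+ prog) :
    (straightLine prog).HaltsFrom W (config _ h (tape prog v v.length) o) C ↔
      (∃ d, W.adoc u = some d ∧ W.data d = {t}) ∧
        (straightLine prog).HaltsFrom W (config l ((List.suffix_append _ l).trans h)
          (tape prog (v ++ encURI u ++ (encTriples {t} ++ [Sym.sharp]))
            (v ++ encURI u ++ (encTriples {t} ++ [Sym.sharp])).length) o) C := by
  have h' : (encURI u).map Instr.write ++
      (Instr.expand :: ((encTriples {t} ++ [Sym.sharp]).map Instr.check ++ l)) <:+ prog := by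
    simpa [fetch] using h
  have e : config _ h (tape prog v v.length) o = config _ h' (tape prog v v.length) o := by
    simp [fetch]
  have hu : (encURI u).map (fun a => some (Sum.inl a)) <:+
      (tape prog (v ++ encURI u) 0).cells := by
    simp [tape]
  rw [e, haltsFrom_write, haltsFrom_expand, haltsFrom_check]
  constructor
  · rintro ⟨⟨r, hr⟩, hC⟩
    rcases hd : W.adoc u with _ | d
    · rw [lookup_of_adoc_eq_none hu hd, encTriples_singleton] at hr
      simp at hr
    · rw [lookup_of_adoc_eq_some hu hd, Web.encDoc] at hr hC
      rw [List.append_assoc] at hr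
      obtain ⟨hT, -⟩ := eq_singleton_of_encTriples_append hr
      rw [hT] at hC
      exact ⟨⟨d, rfl, hT⟩, hC⟩
  · rintro ⟨⟨d, hd, hT⟩, hC⟩
    rw [lookup_of_adoc_eq_some hu hd, Web.encDoc, hT]
    exact ⟨List.prefix_rfl, hC⟩

/-- The final tape `T` is left unspecified because the output phase does not depend on it. -/
theorem exists_haltsFrom_flatMap_fetch (g : ℕ → ℕ) (is : List ℕ)
    (h : is.flatMap (fun i => fetch ⟨i⟩ (linkTriple (g i))) ++ l <:+ prog) :
    ∃ T, ∀ C, (straightLine prog).HaltsFrom W (config _ h (tape prog v v.length) o) C ↔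
      (∀ i ∈ is, ∃ d, W.adoc ⟨i⟩ = some d ∧ W.data d = {linkTriple (g i)}) ∧
        (straightLine prog).HaltsFrom W
          (config l ((List.suffix_append _ l).trans h) T o) C := by
  induction is generalizing v with
  | nil => exact ⟨tape prog v v.length, fun C => by simp⟩
  | cons i is ih =>
    have h' : fetch ⟨i⟩ (linkTriple (g i)) ++
        (is.flatMap (fun i => fetch ⟨i⟩ (linkTriple (g i))) ++ l) <:+ prog := by
      simpa using h
    obtain ⟨T, hT⟩ := ih (v := v ++ encURI ⟨i⟩ ++ (encTriples {linkTriple (g i)} ++ [Sym.sharp]))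
      ((List.suffix_append _ _).trans h')
    refine ⟨T, fun C => ?_⟩
    have e : config _ h (tape prog v v.length) o = config _ h' (tape prog v v.length) o := by
      simp
    rw [e, haltsFrom_fetch, hT, List.forall_mem_cons, and_assoc]

end straightLine

/-! ### The termination problem -/

/-- The program that halts on the Webs that contain the first `N + 1` documents of
`linkWeb (cycle N)`, with the query result as output. -/
noncomputable def cycleProgram (N : ℕ) : List Instr :=
  (List.range (N + 1)).flatMap (fun i => straightLine.fetch ⟨i⟩ (linkTriple (cycle N i))) ++
    (encUriValuations N).map .out

theorem exists_haltsIn_cycleProgram (N : ℕ) (W : Web) :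
    ∃ C₁, C₁.output = encUriValuations N ∧
      ∀ C, (straightLine (cycleProgram N)).HaltsIn W [] C ↔ ContainsCycle W N ∧ C = C₁ := by
  obtain ⟨T, hT⟩ := straightLine.exists_haltsFrom_flatMap_fetch (prog := cycleProgram N)
    (W := W) (v := []) (o := []) (l := (encUriValuations N).map .out) (cycle N)
    (List.range (N + 1)) List.suffix_rfl
  obtain ⟨C₁, h₁, h₂⟩ := straightLine.exists_haltsFrom_out (prog := cycleProgram N)
    (W := W) (o := []) (encUriValuations N) (List.suffix_append _ _) T
  refine ⟨C₁, h₁, fun C => ?_⟩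
  have hC := hT C
  rw [h₂] at hC
  -- The initial configuration on empty input is by definition the `config` with the whole program
  -- remaining.
  refine Iff.trans hC ?_
  simp only [ContainsCycle, List.mem_range, Nat.lt_succ_iff]

/-- The input that asks for `(?x, ?x, ?x)` in the documents that can be reached from the URI with
index `0`. -/
def diagonalInput : TerminationInput where
  S := {⟨0⟩}
  S_nonempty := Finset.singleton_nonempty _
  c := .all
  c_not_finite := Criterion.not_ensuresFiniteness_all
  P := diagonalExpr

theorem termination_subset_terminationNonuniform : termination ⊆ terminationNonuniform :=
  fun _ ⟨M, _, hM⟩ => ⟨M, hM⟩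

theorem linkWeb_cycle_mem_termination (N : ℕ) :
    (linkWeb (cycle N), diagonalInput) ∈ termination := by
  refine ⟨straightLine (cycleProgram N), fun W C hC => ?_, ?_⟩
  · obtain ⟨C₁, h₁, h₂⟩ := exists_haltsIn_cycleProgram N W
    obtain ⟨hW, rfl⟩ := (h₂ C).1 hC
    rw [h₁]
    exact hW.encodesSet
  · obtain ⟨C₁, h₁, h₂⟩ := exists_haltsIn_cycleProgram N (linkWeb (cycle N))
    refine ⟨C₁, (h₂ C₁).2 ⟨containsCycle_linkWeb N, rfl⟩, ?_⟩
    rw [h₁]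
    exact (containsCycle_linkWeb N).encodesSet

theorem linkWeb_succ_notMem_terminationNonuniform :
    (linkWeb Nat.succ, diagonalInput) ∉ terminationNonuniform := by
  rintro ⟨M, C, -, hC⟩
  exact infinite_reachQuery_linkWeb_succ hC.finite

/-- The rejecting run on the chain is also the run on a large cycle, where acceptance is required.
Any problem between the two readings is covered, so one argument settles both. -/
theorem not_lDMachineDecidable_of_subset (enc : TerminationInput → List Sym)
    {DP : Set (Web × TerminationInput)} (h₁ : termination ⊆ DP) (h₂ : DP ⊆ terminationNonuniform) :
    ¬ LDMachineDecidable enc DP := by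
  rintro ⟨M, hM⟩
  obtain ⟨C, hC, -, hrej⟩ := hM (linkWeb Nat.succ) diagonalInput
  obtain ⟨N, hN⟩ := LDMachine.HaltsFrom.exists_forall_cycle hC
  obtain ⟨C', hC', hacc, -⟩ := hM (linkWeb (cycle N)) diagonalInput
  obtain rfl : C = C' := LDMachine.HaltsFrom.unique (hN N le_rfl) hC'
  exact Set.disjoint_left.1 M.disjoint (hacc (h₁ (linkWeb_cycle_mem_termination N)))
    (hrej fun h => linkWeb_succ_notMem_terminationNonuniform (h₂ h))

end LinkedData

theorem mainTheorem10 (enc : LinkedData.TerminationInput → List LinkedData.Sym) :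
    ¬ LinkedData.LDMachineDecidable enc LinkedData.termination ∧
    ¬ LinkedData.LDMachineDecidable enc LinkedData.terminationNonuniform :=
  ⟨LinkedData.not_lDMachineDecidable_of_subset enc subset_rfl
      LinkedData.termination_subset_terminationNonuniform,
    LinkedData.not_lDMachineDecidable_of_subset enc
      LinkedData.termination_subset_terminationNonuniform subset_rfl⟩
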